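/- For a positive semidefinite operator $X$ on a finite-dimensional complex Hilbert space, let $\operatorname{supp}(X)$ be the orthogonal complement of its kernel; for real $y\neq 0$ the power $X^{y}$ is taken on $\operatorname{supp}(X)$ and is $0$ on the kernel of $X$. For $\alpha\in(1,\infty)$ and positive semidefinite operators $A,B$ on the same space, the sandwiched quasi-relative entropy is $$\widetilde Q_\alpha(A\|B)=\begin{cases}\operatorname{Tr}\Big\{\big(B^{\frac{1-\alpha}{2\alpha}}AB^{\frac{1-\alpha}{2\alpha}}\big)^{\alpha}\Big\} & \text{if }\operatorname{supp}(A)\subseteq\operatorname{supp}(B),\\ \infty & \text{otherwise,}\end{cases}$$ and the sandwiched Rényi relative entropy is $$\widetilde D_\alpha(A\|B)=\frac{1}{\alpha-1}\log_2\widetilde Q_\alpha(A\|B)\in[-\infty,\infty],$$ where $\log_2 0=-\infty$ and $\log_2\infty=\infty$. **Corollary (Monotonicity).** Let $\mathcal H,\mathcal K$ be finite-dimensional complex Hilbert spaces, let $\alpha\in(1,2]$, let $\mathcal N:\mathcal B(\mathcal H)\to\mathcal B(\mathcal K)$ be a quantum channel, that is, a completely positive and trace-preserving linear map, and let $A,B\in\mathcal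 B(\mathcal H)$ be positive semidefinite. Then $$\widetilde Q_\alpha(A\|B)\ \ge\ \widetilde Q_\alpha(\mathcal N(A)\|\mathcal N(B))\qquad\text{and}\qquad \widetilde D_\alpha(A\|B)\ \ge\ \widetilde D_\alpha(\mathcal N(A)\|\mathcal N(B)).$$ -/

import Mathlib

open scoped ENNReal CStarAlgebra

noncomputable section

section Operators

variable {H : Type*} [NormedAddCommGroup H] [InnerProductSpace ℂ H]

/-- The trace of an operator on a finite-dimensional Hilbert space. -/
def opTrace (X : H →L[ℂ] H) : ℂ :=
  LinearMap.trace ℂ H (X : H →ₗ[ℂ] H)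

/-- The support of an operator: the orthogonal complement of its kernel. -/
def opSupport (X : H →L[ℂ] H) : Submodule ℂ H :=
  (LinearMap.ker (X : H →ₗ[ℂ] H))ᗮ

variable [CompleteSpace H]

open Classical in
/-- The sandwiched quasi-relative entropy `Q̃_α(A‖B)` of positive semidefinite operators on a
finite-dimensional Hilbert space. Real powers are taken by the functional calculus, with
`0 ^ y = 0` for real `y ≠ 0`: a negative power of `B` is the power of its inverse on the support
of `B` and vanishes on the kernel of `B`. For `A, B ≥ 0` the trace is real and nonnegative. -/
def sandwichedQ (α : ℝ) (A B : H →L[ℂ] H) : ℝ≥0∞ :=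
  if opSupport A ≤ opSupport B then
    ENNReal.ofReal
      (opTrace ((B ^ ((1 - α) / (2 * α)) * A * B ^ ((1 - α) / (2 * α))) ^ α)).re
  else ⊤

/-- The sandwiched Rényi relative entropy `D̃_α(A‖B) = (α - 1)⁻¹ log₂ Q̃_α(A‖B)`, an extended real
number; `ENNReal.log` is the natural logarithm with `log 0 = -∞` and `log ∞ = ∞`. -/
def sandwichedD (α : ℝ) (A B : H →L[ℂ] H) : EReal :=
  ((1 / (α - 1) : ℝ) : EReal) *
    (((1 / Real.log 2 : ℝ) : EReal) * ENNReal.log (sandwichedQ α A B))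

end Operators

section Channels

variable {H K : Type*}
  [NormedAddCommGroup H] [InnerProductSpace ℂ H] [CompleteSpace H]
  [NormedAddCommGroup K] [InnerProductSpace ℂ K] [CompleteSpace K]

/-- A linear map between operator algebras is a quantum channel if it is completely positive
and trace-preserving. -/
structure IsQuantumChannel (N : (H →L[ℂ] H) →ₗ[ℂ] (K →L[ℂ] K)) : Prop where
  /-- For each `k`, applying `N` to the entries of `k × k` operator matrices, which is the map
  `id ⊗ N` with a `k`-dimensional reference system, preserves positivity. -/
  completelyPositive : ∃ Φ : (H →L[ℂ] H) →CP (K →L[ℂ] K), Φ.toLinearMap = N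
  tracePreserving : ∀ X : H →L[ℂ] H, opTrace (N X) = opTrace X

end Channels

end

/-! The proof is complex interpolation. If supp A is not contained in supp B, the right-hand side is
infinite. Otherwise A ≤ cB for some c, so Φ A ≤ c Φ B and the inclusion of supports survives Φ.
Write σ = B, τ = Φ σ, s = (1-α)/(2α), P = σ^s A σ^s and R = τ^s Φ(A) τ^s; the claim is r = Tr R^α ≤
q = Tr P^α. The entire function f(z) = Tr[τ^((z-1)/2) Φ(σ^((1-z)/2) P^(αz) σ^((1-z)/2)) τ^((z-1)/2)
R^(α(1-z))] takes the value r at z = 1/α. On Re z = 0 everything except R^α is a contraction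
(`norm_conj_map_opCpow_le_one`), so |f| ≤ r. On Re z = 1 the outer factors are contractions and the
trace-norm estimate `norm_opTrace_map_mul_le` gives |f| ≤ q. Hadamard's three lines theorem yields r
≤ r^(1-1/α) q^(1/α), hence r ≤ q. Both edge estimates are Cauchy–Schwarz arguments made possible by
positivity of Φ on 2 × 2 blocks (`CompletelyPositiveMap.exists_factorization`). The statement for D̃
follows by monotonicity of the logarithm. -/

noncomputable section

/-! ### Complex powers of positive operators and their analyticity. -/

section Powers

variable {H : Type*} [NormedAddCommGroup H] [InnerProductSpace ℂ H] [FiniteDimensional ℂ H]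

theorem opSpectrum_finite (X : H →L[ℂ] H) : (spectrum ℂ X).Finite := by
  have h := AlgEquiv.spectrum_eq (Module.End.toContinuousLinearMap (𝕜 := ℂ) H)
    (X : H →ₗ[ℂ] H)
  have h2 : Module.End.toContinuousLinearMap (𝕜 := ℂ) H (X : H →ₗ[ℂ] H) = X := by
    ext; rfl
  rw [h2] at h
  rw [h]
  exact Module.End.finite_spectrum _

/-- A finite spectrum is discrete, so the functional calculus accepts functions that jump at 0, as
the powers on the support do. -/
theorem opSpectrum_continuousOn (X : H →L[ℂ] H) (f : ℂ → ℂ) : ContinuousOn f (spectrum ℂ X) :=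
  (opSpectrum_finite X).continuousOn f

end Powers

section Powers

variable {H : Type*} [NormedAddCommGroup H] [InnerProductSpace ℂ H] [CompleteSpace H]

theorem opSpectrum_nonneg {X : H →L[ℂ] H} (hX : 0 ≤ X) {x : ℂ} (hx : x ∈ spectrum ℂ X) :
    ∃ r : ℝ, 0 ≤ r ∧ x = r := by
  have hsa : IsSelfAdjoint X := .of_nonneg hX
  have h := hsa.mem_spectrum_eq_re hx
  refine ⟨x.re, ?_, h⟩
  rw [h] at hx
  exact spectrum_nonneg_of_nonneg hX (spectrum.of_algebraMap_mem ℂ hx)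

/-- Complex powers of a positive operator, taken on its support and vanishing on its kernel. -/
def opCpow (X : H →L[ℂ] H) (z : ℂ) : H →L[ℂ] H :=
  cfc (fun x : ℂ => if x = 0 then 0 else x ^ z) X

theorem opCpow_one {X : H →L[ℂ] H} (hX : 0 ≤ X) : opCpow X 1 = X := by
  have hn : IsStarNormal X := (IsSelfAdjoint.of_nonneg hX).isStarNormal
  unfold opCpow
  conv_rhs => rw [← cfc_id' ℂ X]
  congr 1
  ext x
  split_ifs with h <;> simp [h]

theorem star_opCpow {X : H →L[ℂ] H} (hX : 0 ≤ X) (z : ℂ) :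
    star (opCpow X z) = opCpow X (starRingEnd ℂ z) := by
  unfold opCpow
  rw [← cfc_star]
  refine cfc_congr fun x hx => ?_
  obtain ⟨r, hr, rfl⟩ := opSpectrum_nonneg hX hx
  split_ifs with h
  · simp
  · rw [Complex.cpow_conj _ _ (by simp [Complex.arg_ofReal_of_nonneg hr, Real.pi_ne_zero.symm])]
    simp

theorem rpow_eq_opCpow {X : H →L[ℂ] H} (hX : 0 ≤ X) {y : ℝ} (hy : y ≠ 0) :
    X ^ y = opCpow X y := by
  rw [CFC.rpow_def, cfc_nnreal_eq_real _ X hX, cfc_real_eq_complex _ (.of_nonneg hX)]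
  unfold opCpow
  refine cfc_congr fun x hx => ?_
  obtain ⟨r, hr, rfl⟩ := opSpectrum_nonneg hX hx
  split_ifs with h
  · simp [Complex.ofReal_eq_zero.1 h, Real.zero_rpow hy]
  · rw [← Complex.ofReal_cpow hr]
    simp [hr]

theorem norm_opCpow_le_one {X : H →L[ℂ] H} (hX : 0 ≤ X) {z : ℂ} (hz : z.re = 0) :
    ‖opCpow X z‖ ≤ 1 := by
  refine norm_cfc_le zero_le_one fun x hx => ?_
  obtain ⟨r, hr, rfl⟩ := opSpectrum_nonneg hX hx
  split_ifs with h
  · simp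
  · have : 0 < r := lt_of_le_of_ne hr fun h0 => h (by simp [← h0])
    rw [Complex.norm_cpow_eq_rpow_re_of_pos this, hz, Real.rpow_zero]

variable [FiniteDimensional ℂ H]

/-- For X ≥ 0, opposite exponents multiply to `opCpow X 0`, the projection onto the support, and not
to the identity. -/
theorem opCpow_mul_opCpow (X : H →L[ℂ] H) (z w : ℂ) :
    opCpow X z * opCpow X w = opCpow X (z + w) := by
  unfold opCpow
  rw [← cfc_mul _ _ X (opSpectrum_continuousOn X _) (opSpectrum_continuousOn X _)]
  congr 1
  ext x
  split_ifs with h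
  · simp
  · rw [Complex.cpow_add _ _ h]

theorem opCpow_nonneg {X : H →L[ℂ] H} (hX : 0 ≤ X) (y : ℝ) : 0 ≤ opCpow X (y : ℂ) := by
  have h : opCpow X (y : ℂ) = star (opCpow X ((y / 2 : ℝ) : ℂ)) * opCpow X ((y / 2 : ℝ) : ℂ) := by
    rw [star_opCpow hX, opCpow_mul_opCpow]
    congr 1
    rw [Complex.conj_ofReal]
    push_cast
    ring
  rw [h]
  exact star_mul_self_nonneg _

/-- A function with values in a normed algebra is tame on the strip `0 ≤ Re z ≤ 1` if it is entire
and bounded there. -/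
def TameOnStrip {E : Type*} [NormedAddCommGroup E] [NormedSpace ℂ E] (F : ℂ → E) : Prop :=
  Differentiable ℂ F ∧ ∃ C : ℝ, ∀ z : ℂ, 0 ≤ z.re → z.re ≤ 1 → ‖F z‖ ≤ C

theorem TameOnStrip.const {E : Type*} [NormedAddCommGroup E] [NormedSpace ℂ E] (e : E) :
    TameOnStrip fun _ => e :=
  ⟨differentiable_const _, ‖e‖, fun _ _ _ => le_rfl⟩

theorem TameOnStrip.mul {E : Type*} [NormedRing E] [NormedAlgebra ℂ E] {F G : ℂ → E}
    (hF : TameOnStrip F) (hG : TameOnStrip G) : TameOnStrip fun z => F z * G z := by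
  obtain ⟨hF, C, hC⟩ := hF
  obtain ⟨hG, D, hD⟩ := hG
  refine ⟨hF.mul hG, C * D, fun z h0 h1 => (norm_mul_le _ _).trans ?_⟩
  exact mul_le_mul (hC z h0 h1) (hD z h0 h1) (norm_nonneg _) ((norm_nonneg _).trans (hC z h0 h1))

theorem TameOnStrip.smul_const {E : Type*} [NormedAddCommGroup E] [NormedSpace ℂ E] {g : ℂ → ℂ}
    (hg : TameOnStrip g) (e : E) : TameOnStrip fun z => g z • e := by
  obtain ⟨hg, C, hC⟩ := hg
  refine ⟨hg.smul_const e, C * ‖e‖, fun z h0 h1 => ?_⟩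
  rw [norm_smul]
  exact mul_le_mul_of_nonneg_right (hC z h0 h1) (norm_nonneg _)

theorem TameOnStrip.sum {E ι : Type*} [NormedAddCommGroup E] [NormedSpace ℂ E] {s : Finset ι}
    {F : ι → ℂ → E} (hF : ∀ i ∈ s, TameOnStrip (F i)) : TameOnStrip fun z => ∑ i ∈ s, F i z := by
  classical
  choose! h C hC using hF
  refine ⟨Differentiable.fun_sum h, ∑ i ∈ s, C i, fun z h0 h1 => ?_⟩
  exact norm_sum_le_of_le _ fun i hi => hC i hi z h0 h1

theorem TameOnStrip.clm {E F : Type*} [NormedAddCommGroup E] [NormedSpace ℂ E]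
    [NormedAddCommGroup F] [NormedSpace ℂ F] (L : E →L[ℂ] F) {G : ℂ → E}
    (hG : TameOnStrip G) : TameOnStrip fun z => L (G z) := by
  obtain ⟨hG, C, hC⟩ := hG
  refine ⟨L.differentiable.comp hG, ‖L‖ * C, fun z h0 h1 => (L.le_opNorm _).trans ?_⟩
  exact mul_le_mul_of_nonneg_left (hC z h0 h1) (norm_nonneg _)

theorem TameOnStrip.linearMap {E F : Type*} [NormedAddCommGroup E] [NormedSpace ℂ E]
    [FiniteDimensional ℂ E] [NormedAddCommGroup F] [NormedSpace ℂ F] (L : E →ₗ[ℂ] F) {G : ℂ → E}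
    (hG : TameOnStrip G) : TameOnStrip fun z => L (G z) :=
  TameOnStrip.clm (LinearMap.toContinuousLinearMap L) hG

theorem tameOnStrip_cpow {r : ℝ} (hr : 0 < r) (a b : ℝ) :
    TameOnStrip fun z : ℂ => (r : ℂ) ^ (a * z + b : ℂ) := by
  have hr' : (r : ℂ) ≠ 0 := by exact_mod_cast hr.ne'
  refine ⟨fun z => ?_, ?_⟩
  · exact DifferentiableAt.const_cpow (by fun_prop) (Or.inl hr')
  · have hc : ContinuousOn (fun x : ℝ => r ^ (a * x + b)) (Set.Icc 0 1) :=
      (Continuous.rpow continuous_const (by fun_prop) fun _ => Or.inl hr.ne').continuousOn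
    obtain ⟨C, hC⟩ := isCompact_Icc.exists_bound_of_continuousOn hc
    refine ⟨C, fun z h0 h1 => ?_⟩
    rw [Complex.norm_cpow_eq_rpow_re_of_pos hr]
    simpa using (le_abs_self _).trans (hC z.re ⟨h0, h1⟩)

theorem tameOnStrip_opCpow {X : H →L[ℂ] H} (hX : 0 ≤ X) (a b : ℝ) :
    TameOnStrip fun z : ℂ => opCpow X (a * z + b) := by
  classical
  set S := (opSpectrum_finite X).toFinset
  -- Spectral decomposition: z enters only through the scalar powers of the finitely many
  -- eigenvalues.
  have key : ∀ z : ℂ, opCpow X (a * z + b) =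
      ∑ l ∈ S, (if l = 0 then 0 else l ^ (a * z + b : ℂ)) •
        cfc (fun x : ℂ => if x = l then (1 : ℂ) else 0) X := by
    intro z
    have : ∀ l ∈ S, (if l = 0 then 0 else l ^ (a * z + b : ℂ)) •
        cfc (fun x : ℂ => if x = l then (1 : ℂ) else 0) X =
        cfc (fun x : ℂ => (if l = 0 then 0 else l ^ (a * z + b : ℂ)) •
          (if x = l then (1 : ℂ) else 0)) X := by
      intro l _
      rw [cfc_smul _ _ _ (opSpectrum_continuousOn X _)]
    have hn : IsStarNormal X := (IsSelfAdjoint.of_nonneg hX).isStarNormal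
    rw [Finset.sum_congr rfl this, ← cfc_sum _ _ _ (fun i _ => opSpectrum_continuousOn X _)]
    refine cfc_congr fun x hx => ?_
    have hx' : x ∈ S := by simpa [S] using hx
    simp [Finset.sum_apply, hx']
  simp_rw [key]
  refine TameOnStrip.sum fun l hl => TameOnStrip.smul_const ?_ _
  obtain ⟨r, hr, rfl⟩ := opSpectrum_nonneg hX (by simpa [S] using hl : l ∈ spectrum ℂ X)
  split_ifs with h
  · exact TameOnStrip.const 0
  · exact tameOnStrip_cpow (lt_of_le_of_ne hr fun h0 => h (by simp [← h0])) a b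

end Powers

/-! ### Trace inequalities of Hilbert–Schmidt type. -/

section Trace

variable {H : Type*} [NormedAddCommGroup H] [InnerProductSpace ℂ H]

theorem opTrace_mul_comm (X Y : H →L[ℂ] H) : opTrace (X * Y) = opTrace (Y * X) :=
  LinearMap.trace_mul_comm ℂ (X : H →ₗ[ℂ] H) (Y : H →ₗ[ℂ] H)

theorem opTrace_sum {ι : Type*} (s : Finset ι) (F : ι → H →L[ℂ] H) :
    opTrace (∑ i ∈ s, F i) = ∑ i ∈ s, opTrace (F i) := by
  simp [opTrace]

variable [FiniteDimensional ℂ H]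

theorem opTrace_eq_sum_inner (X : H →L[ℂ] H) :
    opTrace X = ∑ i, inner ℂ (stdOrthonormalBasis ℂ H i) (X (stdOrthonormalBasis ℂ H i)) :=
  LinearMap.trace_eq_sum_inner _ _

variable [CompleteSpace H]

theorem opTrace_star_mul_self (X : H →L[ℂ] H) :
    opTrace (star X * X) = ((∑ i, ‖X (stdOrthonormalBasis ℂ H i)‖ ^ 2 : ℝ) : ℂ) := by
  rw [opTrace_eq_sum_inner, Complex.ofReal_sum]
  refine Finset.sum_congr rfl fun i _ => ?_
  rw [mul_apply_eq_comp, ContinuousLinearMap.star_eq_adjoint,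
    ContinuousLinearMap.adjoint_inner_right, inner_self_eq_norm_sq_to_K]
  simp

theorem opTrace_re_nonneg {X : H →L[ℂ] H} (hX : 0 ≤ X) : 0 ≤ (opTrace X).re := by
  obtain ⟨b, rfl⟩ := CStarAlgebra.nonneg_iff_eq_star_mul_self.1 hX
  rw [opTrace_star_mul_self, Complex.ofReal_re]
  positivity

/-- The Cauchy–Schwarz inequality for the Hilbert–Schmidt inner product, with a contraction. -/
theorem norm_opTrace_mul_le {ι : Type*} [Fintype ι] (S R : ι → H →L[ℂ] H) {V : H →L[ℂ] H}
    (hV : ‖V‖ ≤ 1) {c : ℝ} (hS : (opTrace (∑ k, star (S k) * S k)).re ≤ c)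
    (hR : (opTrace (∑ k, star (R k) * R k)).re ≤ c) :
    ‖opTrace ((∑ k, star (S k) * R k) * V)‖ ≤ c := by
  set e := stdOrthonormalBasis ℂ H
  rw [opTrace_sum, Finset.sum_congr rfl fun k _ => opTrace_star_mul_self _,
    ← Complex.ofReal_sum, Complex.ofReal_re] at hS hR
  -- Cycling the trace puts adjoints on the basis vectors; an operator and its adjoint have the same
  -- Hilbert–Schmidt norm.
  have hstar : ∀ Z : H →L[ℂ] H, ∑ i, ‖star Z (e i)‖ ^ 2 = ∑ i, ‖Z (e i)‖ ^ 2 := by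
    intro Z
    have h1 := opTrace_star_mul_self (star Z)
    rw [star_star, opTrace_mul_comm, opTrace_star_mul_self] at h1
    exact_mod_cast h1.symm
  have h1 : opTrace ((∑ k, star (S k) * R k) * V) =
      ∑ k, ∑ i, inner ℂ (star V (star (R k) (e i))) (star (S k) (e i)) := by
    have : ∀ k, opTrace (star (S k) * R k * V) =
        ∑ i, inner ℂ (star V (star (R k) (e i))) (star (S k) (e i)) := by
      intro k
      rw [mul_assoc, opTrace_mul_comm, opTrace_eq_sum_inner]
      refine Finset.sum_congr rfl fun i _ => ?_
      simp only [ContinuousLinearMap.star_eq_adjoint, mul_apply_eq_comp,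
        ContinuousLinearMap.adjoint_inner_left]
      rfl
    rw [Finset.sum_mul, opTrace_sum, Finset.sum_congr rfl fun k _ => this k]
  rw [h1]
  calc _ ≤ ∑ k, ∑ i, (‖R k (e i)‖ ^ 2 / 2 + ‖S k (e i)‖ ^ 2 / 2) := by
        refine norm_sum_le_of_le _ fun k _ => ?_
        rw [Finset.sum_add_distrib, ← Finset.sum_div, ← Finset.sum_div, ← hstar (R k),
          ← hstar (S k), Finset.sum_div, Finset.sum_div, ← Finset.sum_add_distrib]
        refine norm_sum_le_of_le _ fun i _ => (norm_inner_le_norm _ _).trans ?_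
        have h2 : ‖star V (star (R k) (e i))‖ ≤ ‖star (R k) (e i)‖ := by
          refine ((star V).le_opNorm _).trans ?_
          rw [norm_star]
          exact mul_le_of_le_one_left (norm_nonneg _) hV
        nlinarith [sq_nonneg (‖star (R k) (e i)‖ - ‖star (S k) (e i)‖),
          norm_nonneg (star (S k) (e i))]
    _ = (∑ k, ∑ i, ‖R k (e i)‖ ^ 2) / 2 + (∑ k, ∑ i, ‖S k (e i)‖ ^ 2) / 2 := by
        simp only [Finset.sum_add_distrib, Finset.sum_div]
    _ ≤ c := by linarith

theorem norm_opTrace_contraction_mul_le {V X : H →L[ℂ] H} (hV : ‖V‖ ≤ 1) (hX : 0 ≤ X) :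
    ‖opTrace (X * V)‖ ≤ (opTrace X).re := by
  obtain ⟨b, rfl⟩ := CStarAlgebra.nonneg_iff_eq_star_mul_self.1 hX
  have := norm_opTrace_mul_le (fun _ : Unit => b) (fun _ => b) hV (c := (opTrace (star b * b)).re)
    (by simp) (by simp)
  simpa using this

end Trace

/-! ### Cauchy–Schwarz for completely positive maps. -/

section CompletelyPositive

/-- If `∑ S* S` and `∑ R* R` are bounded by `Q`, and `U` and `U'` compress `Q` to a contraction,
then `U* (∑ S* R) U'` is a contraction. -/
theorem norm_conj_sum_le_one {H : Type*} [NormedAddCommGroup H] [InnerProductSpace ℂ H]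
    [CompleteSpace H] {ι : Type*} [Fintype ι] (S R : ι → H →L[ℂ] H)
    {Q U U' : H →L[ℂ] H} (hS : ∑ k, star (S k) * S k ≤ Q) (hR : ∑ k, star (R k) * R k ≤ Q)
    (hU : star U * Q * U ≤ 1) (hU' : star U' * Q * U' ≤ 1) :
    ‖star U * (∑ k, star (S k) * R k) * U'‖ ≤ 1 := by
  have aux : ∀ (T : ι → H →L[ℂ] H) (W : H →L[ℂ] H), ∑ k, star (T k) * T k ≤ Q →
      star W * Q * W ≤ 1 → ∀ v : H, ∑ k, ‖T k (W v)‖ ^ 2 ≤ ‖v‖ ^ 2 := by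
    intro T W hT hW v
    have h := (star_left_conjugate_le_conjugate hT W).trans hW
    have h2 := (ContinuousLinearMap.nonneg_iff_isPositive _).1 (sub_nonneg.2 h)
    have h3 := h2.re_inner_nonneg_right v
    simp only [sub_apply, mul_apply_eq_comp,
      sum_apply, one_apply_eq_self, inner_sub_right,
      ContinuousLinearMap.star_eq_adjoint, ContinuousLinearMap.adjoint_inner_right, inner_sum,
      map_sub, map_sum, inner_self_eq_norm_sq] at h3
    linarith
  refine ContinuousLinearMap.opNorm_le_bound _ zero_le_one fun v => ?_
  rw [one_mul]
  obtain ⟨w, hw⟩ : ∃ w, w = (star U * (∑ k, star (S k) * R k) * U') v := ⟨_, rfl⟩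
  rw [← hw]
  have h1 : (‖w‖ ^ 2 : ℝ) = ‖∑ k, inner ℂ (S k (U w)) (R k (U' v))‖ := by
    have : inner ℂ w w = ∑ k, inner ℂ (S k (U w)) (R k (U' v)) := by
      nth_rewrite 2 [hw]
      simp only [mul_apply_eq_comp, sum_apply,
        ContinuousLinearMap.star_eq_adjoint, ContinuousLinearMap.adjoint_inner_right, inner_sum]
    rw [← this, inner_self_eq_norm_sq_to_K]
    simp
  have h2 : ‖w‖ ^ 2 ≤ ‖w‖ ^ 2 / 2 + ‖v‖ ^ 2 / 2 := by
    calc ‖w‖ ^ 2 ≤ ∑ k, (‖S k (U w)‖ ^ 2 / 2 + ‖R k (U' v)‖ ^ 2 / 2) := by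
          rw [h1]
          refine norm_sum_le_of_le _ fun k _ => (norm_inner_le_norm _ _).trans ?_
          nlinarith [sq_nonneg (‖S k (U w)‖ - ‖R k (U' v)‖)]
      _ = (∑ k, ‖S k (U w)‖ ^ 2) / 2 + (∑ k, ‖R k (U' v)‖ ^ 2) / 2 := by
          simp only [Finset.sum_add_distrib, Finset.sum_div]
      _ ≤ _ := by linarith [aux S U hS hU w, aux R U' hR hU' v]
  exact (sq_le_sq₀ (norm_nonneg _) (norm_nonneg _)).1 (by linarith)

variable {H K : Type*}
  [NormedAddCommGroup H] [InnerProductSpace ℂ H] [CompleteSpace H]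
  [NormedAddCommGroup K] [InnerProductSpace ℂ K] [CompleteSpace K]

theorem CStarAlgebra.exists_eq_star_mul_self {A : Type*} [CStarAlgebra A] [PartialOrder A]
    [StarOrderedRing A] {a : A} (ha : 0 ≤ a) : ∃ b, a = star b * b :=
  CStarAlgebra.nonneg_iff_eq_star_mul_self.1 ha

/-- A completely positive map sends a factorization `C * D` to a sum of products that is
compatible with the images of `C * star C` and `star D * D`. -/
theorem CompletelyPositiveMap.exists_factorization (Φ : (H →L[ℂ] H) →CP (K →L[ℂ] K))
    (C D : H →L[ℂ] H) : ∃ S R : Fin 2 → K →L[ℂ] K,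
      Φ (C * D) = ∑ k, star (S k) * R k ∧ Φ (C * star C) = ∑ k, star (S k) * S k ∧
        Φ (star D * D) = ∑ k, star (R k) * R k := by
  -- `star M * M` is the positive block matrix with rows (C C*, C D) and (D* C*, D* D); its image
  -- under Φ is again of the form T* T.
  let M : CStarMatrix (Fin 2) (Fin 2) (H →L[ℂ] H) := CStarMatrix.ofMatrix !![star C, D; 0, 0]
  have hM : 0 ≤ (star M * M).map Φ := Φ.map_cstarMatrix_nonneg _ (star_mul_self_nonneg M)
  obtain ⟨T, hT⟩ := CStarAlgebra.exists_eq_star_mul_self hM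
  have hent : ∀ i j, Φ ((star M * M) i j) = ∑ k, star (T k i) * T k j := by
    intro i j
    have := congrArg (fun Z : CStarMatrix (Fin 2) (Fin 2) (K →L[ℂ] K) => Z i j) hT
    simpa [CStarMatrix.mul_apply, CStarMatrix.star_apply] using this
  refine ⟨fun k => T k 0, fun k => T k 1, ?_, ?_, ?_⟩
  · rw [← hent 0 1]
    simp [M, CStarMatrix.mul_apply, CStarMatrix.star_apply]
  · rw [← hent 0 0]
    simp [M, CStarMatrix.mul_apply, CStarMatrix.star_apply]
  · rw [← hent 1 1]
    simp [M, CStarMatrix.mul_apply, CStarMatrix.star_apply]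

end CompletelyPositive

/-! ### Order, supports and the logarithm. -/

section Order

variable {H K : Type*}
  [NormedAddCommGroup H] [InnerProductSpace ℂ H] [CompleteSpace H]
  [NormedAddCommGroup K] [InnerProductSpace ℂ K] [CompleteSpace K]

theorem isSelfAdjoint_opCpow {X : H →L[ℂ] H} (hX : 0 ≤ X) (y : ℝ) :
    star (opCpow X (y : ℂ)) = opCpow X (y : ℂ) := by
  rw [star_opCpow hX, Complex.conj_ofReal]

theorem opCpow_conj_nonneg {X Y : H →L[ℂ] H} (hX : 0 ≤ X) (hY : 0 ≤ Y) (y : ℝ) :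
    0 ≤ opCpow X (y : ℂ) * Y * opCpow X (y : ℂ) := by
  simpa [isSelfAdjoint_opCpow hX] using star_left_conjugate_nonneg hY (opCpow X (y : ℂ))

theorem opSupport_le_iff (A B : H →L[ℂ] H) :
    opSupport A ≤ opSupport B ↔ ∀ v, B v = 0 → A v = 0 := by
  unfold opSupport
  rw [Submodule.orthogonal_le_orthogonal_iff]
  rfl

theorem apply_eq_zero_of_le {A B : H →L[ℂ] H} (hA : 0 ≤ A) (hAB : A ≤ B) {v : H} (hv : B v = 0) :
    A v = 0 := by
  obtain ⟨b, rfl⟩ := CStarAlgebra.nonneg_iff_eq_star_mul_self.1 hA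
  have h := ((ContinuousLinearMap.nonneg_iff_isPositive _).1
    (sub_nonneg.2 hAB)).re_inner_nonneg_right v
  simp only [sub_apply, mul_apply_eq_comp, inner_sub_right, hv, inner_zero_right,
    ContinuousLinearMap.star_eq_adjoint, ContinuousLinearMap.adjoint_inner_right, map_sub,
    inner_self_eq_norm_sq, map_zero] at h
  have hb : b v = 0 := by
    rw [← norm_eq_zero]
    nlinarith [sq_nonneg ‖b v‖]
  rw [mul_apply_eq_comp, hb, map_zero]

theorem sandwichedD_le_of_sandwichedQ_le {α : ℝ} (hα : 1 < α) {A B : H →L[ℂ] H}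
    {A' B' : K →L[ℂ] K} (h : sandwichedQ α A' B' ≤ sandwichedQ α A B) :
    sandwichedD α A' B' ≤ sandwichedD α A B := by
  have h1 : (0 : EReal) ≤ ((1 / (α - 1) : ℝ) : EReal) :=
    EReal.coe_nonneg.2 (one_div_nonneg.2 (by linarith))
  have h2 : (0 : EReal) ≤ ((1 / Real.log 2 : ℝ) : EReal) :=
    EReal.coe_nonneg.2 (one_div_nonneg.2 (Real.log_nonneg one_le_two))
  exact mul_le_mul_of_nonneg_left
    (mul_le_mul_of_nonneg_left (ENNReal.log_monotone h) h2) h1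

end Order

/-! ### The interpolation argument and monotonicity under channels. -/

section Monotonicity

variable {H K : Type*}
  [NormedAddCommGroup H] [InnerProductSpace ℂ H] [FiniteDimensional ℂ H] [CompleteSpace H]
  [NormedAddCommGroup K] [InnerProductSpace ℂ K] [FiniteDimensional ℂ K] [CompleteSpace K]

theorem opCpow_zero_nonneg {X : H →L[ℂ] H} (hX : 0 ≤ X) : 0 ≤ opCpow X 0 := by
  simpa using opCpow_nonneg hX 0

theorem opCpow_zero_le_one {X : H →L[ℂ] H} (hX : 0 ≤ X) : opCpow X 0 ≤ 1 :=
  (CStarAlgebra.norm_le_one_iff_of_nonneg _ (opCpow_zero_nonneg hX)).1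
    (norm_opCpow_le_one hX Complex.zero_re)

theorem conj_add_self {z : ℂ} {c : ℝ} (h : 2 * z.re = c) : starRingEnd ℂ z + z = c := by
  rw [add_comm, Complex.add_conj, ← h]

theorem norm_mul_le_one {E : Type*} [NormedRing E] {a b : E} (ha : ‖a‖ ≤ 1) (hb : ‖b‖ ≤ 1) :
    ‖a * b‖ ≤ 1 :=
  (norm_mul_le a b).trans (mul_le_one₀ ha (norm_nonneg b) hb)

/-- On the line `Re z = 0`: the map `X ↦ τ^{-1/2} Φ(σ^{1/2} X σ^{1/2}) τ^{-1/2}`, with `τ = Φ σ`,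
sends imaginary powers to contractions. -/
theorem norm_conj_map_opCpow_le_one (Φ : (H →L[ℂ] H) →CP (K →L[ℂ] K)) {σ P : H →L[ℂ] H}
    (hσ : 0 ≤ σ) (hP : 0 ≤ P) {u v : ℂ} (hu : u.re = 1 / 2) (hv : v.re = 0) :
    ‖opCpow (Φ σ) (-u) * Φ (opCpow σ u * opCpow P v * opCpow σ u) * opCpow (Φ σ) (-u)‖ ≤ 1 := by
  have hτ : 0 ≤ Φ σ := map_nonneg Φ hσ
  obtain ⟨S, R, h1, h2, h3⟩ := Φ.exists_factorization (opCpow σ u * opCpow P v) (opCpow σ u)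
  rw [h1]
  have hcu : starRingEnd ℂ u + u = (1 : ℝ) := conj_add_self (by linarith)
  have hσu : star (opCpow σ u) * opCpow σ u = σ := by
    rw [star_opCpow hσ, opCpow_mul_opCpow, hcu, Complex.ofReal_one, opCpow_one hσ]
  have hσu' : opCpow σ u * star (opCpow σ u) = σ := by
    rw [star_opCpow hσ, opCpow_mul_opCpow, add_comm, hcu, Complex.ofReal_one, opCpow_one hσ]
  have hPv : opCpow P v * star (opCpow P v) ≤ 1 := by
    rw [star_opCpow hP, opCpow_mul_opCpow, add_comm, conj_add_self (c := 0) (by linarith)]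
    simpa using opCpow_zero_le_one hP
  have hstar : opCpow (Φ σ) (-u) = star (opCpow (Φ σ) (-(starRingEnd ℂ u))) := by
    rw [star_opCpow hτ]
    simp
  -- The exponents cancel to the support projection of Φ σ, which is at most 1.
  have hone : ∀ a b : ℂ, a + 1 + b = 0 → opCpow (Φ σ) a * Φ σ * opCpow (Φ σ) b ≤ 1 := by
    intro a b hab
    have : opCpow (Φ σ) a * Φ σ * opCpow (Φ σ) b = opCpow (Φ σ) 0 := by
      conv_lhs => enter [1, 2]; rw [← opCpow_one hτ]
      rw [opCpow_mul_opCpow, opCpow_mul_opCpow, hab]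
    rw [this]
    exact opCpow_zero_le_one hτ
  have hcu' : starRingEnd ℂ u + u = 1 := by simpa using hcu
  nth_rewrite 1 [hstar]
  refine norm_conj_sum_le_one S R (Q := Φ σ) ?_ ?_ ?_ ?_
  · rw [← h2]
    refine OrderHomClass.mono Φ ?_
    calc _ = star (star (opCpow σ u)) * (opCpow P v * star (opCpow P v)) * star (opCpow σ u) := by
          simp [star_mul, mul_assoc]
      _ ≤ star (star (opCpow σ u)) * 1 * star (opCpow σ u) :=
          star_left_conjugate_le_conjugate hPv _
      _ = σ := by rw [star_star, mul_one, hσu']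
  · rw [← h3, hσu]
  · rw [← hstar]
    exact hone _ _ (by linear_combination -hcu')
  · rw [star_opCpow hτ]
    exact hone _ _ (by rw [map_neg]; linear_combination -hcu')

/-- On the line `Re z = 1`: a completely positive trace-preserving map does not increase the trace
norm. -/
theorem norm_opTrace_map_mul_le (Φ : (H →L[ℂ] H) →CP (K →L[ℂ] K))
    (hΦ : ∀ X, opTrace (Φ X) = opTrace X) {σ P : H →L[ℂ] H} (hσ : 0 ≤ σ) (hP : 0 ≤ P)
    {u v : ℂ} {β : ℝ} (hu : u.re = 0) (hv : v.re = β) {V : K →L[ℂ] K} (hV : ‖V‖ ≤ 1) :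
    ‖opTrace (Φ (opCpow σ u * opCpow P v * opCpow σ u) * V)‖ ≤ (opTrace (opCpow P (β : ℂ))).re := by
  -- The power of P is split so that both factors have exponents of real part β/2: then C C* and D*
  -- D each have trace Tr(P^β σ^0) ≤ Tr P^β.
  have hfac : opCpow σ u * opCpow P v * opCpow σ u =
      (opCpow σ u * opCpow P (v - (β / 2 : ℝ))) * (opCpow P ((β / 2 : ℝ) : ℂ) * opCpow σ u) := by
    have : opCpow P v = opCpow P (v - (β / 2 : ℝ)) * opCpow P ((β / 2 : ℝ) : ℂ) := by
      rw [opCpow_mul_opCpow, sub_add_cancel]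
    rw [this]
    simp only [mul_assoc]
  have hcu : starRingEnd ℂ u + u = 0 := by simpa using conj_add_self (z := u) (c := 0) (by linarith)
  have hcv : starRingEnd ℂ (v - (β / 2 : ℝ)) + (v - (β / 2 : ℝ)) = (β : ℂ) :=
    conj_add_self (by simp; linarith)
  have hbd : (opTrace (opCpow P (β : ℂ) * opCpow σ 0)).re ≤ (opTrace (opCpow P (β : ℂ))).re :=
    (Complex.re_le_norm _).trans (norm_opTrace_contraction_mul_le
      (norm_opCpow_le_one hσ Complex.zero_re) (opCpow_nonneg hP β))
  rw [hfac]
  obtain ⟨S, R, h1, h2, h3⟩ := Φ.exists_factorization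
    (opCpow σ u * opCpow P (v - (β / 2 : ℝ))) (opCpow P ((β / 2 : ℝ) : ℂ) * opCpow σ u)
  rw [h1]
  refine norm_opTrace_mul_le S R hV ?_ ?_
  · rw [← h2, hΦ, star_mul, star_opCpow hσ, star_opCpow hP, mul_assoc, opTrace_mul_comm,
      mul_assoc, mul_assoc, opCpow_mul_opCpow, hcu, ← mul_assoc, opCpow_mul_opCpow, add_comm, hcv]
    exact hbd
  · rw [← h3, hΦ, star_mul, isSelfAdjoint_opCpow hP, star_opCpow hσ, mul_assoc, opTrace_mul_comm,
      mul_assoc, mul_assoc, opCpow_mul_opCpow, add_comm u, hcu, ← mul_assoc, opCpow_mul_opCpow]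
    rw [← Complex.ofReal_add, add_halves]
    exact hbd

/-- The quantity r also occurs in its own upper bound; for r > 0 the factor r^(1-θ) cancels. -/
theorem le_of_le_interp {r q θ : ℝ} (hr : 0 ≤ r) (hq : 0 ≤ q) (hθ : 0 < θ)
    (h : r ≤ r ^ (1 - θ) * q ^ θ) : r ≤ q := by
  rcases hr.eq_or_lt with rfl | hr
  · exact hq
  have h1 : r ^ (1 - θ) * r ^ θ = r := by
    rw [← Real.rpow_add hr, sub_add_cancel, Real.rpow_one]
  have h2 : r ^ θ ≤ q ^ θ := by
    refine le_of_mul_le_mul_left ?_ (Real.rpow_pos_of_pos hr (1 - θ))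
    rwa [h1]
  exact (Real.rpow_le_rpow_iff hr.le hq hθ).1 h2

/-- Monotonicity of the sandwiched trace functional, by complex interpolation. -/
theorem opTrace_sandwiched_map_le (Φ : (H →L[ℂ] H) →CP (K →L[ℂ] K))
    (hΦ : ∀ X, opTrace (Φ X) = opTrace X) {A σ : H →L[ℂ] H} (hA : 0 ≤ A) (hσ : 0 ≤ σ)
    (hsupp : opCpow σ 0 * A * opCpow σ 0 = A) {α : ℝ} (hα : 1 < α) {s : ℝ}
    (hs : s = (1 - α) / (2 * α)) :
    (opTrace (opCpow (opCpow (Φ σ) s * Φ A * opCpow (Φ σ) s) α)).re ≤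
      (opTrace (opCpow (opCpow σ s * A * opCpow σ s) α)).re := by
  have hα0 : 0 < α := by linarith
  have hτ : 0 ≤ Φ σ := map_nonneg Φ hσ
  set P := opCpow σ s * A * opCpow σ s with hPdef
  set R := opCpow (Φ σ) s * Φ A * opCpow (Φ σ) s with hRdef
  have hP : 0 ≤ P := opCpow_conj_nonneg hσ hA s
  have hR : 0 ≤ R := opCpow_conj_nonneg hτ (map_nonneg Φ hA) s
  set r := (opTrace (opCpow R α)).re
  set q := (opTrace (opCpow P α)).re
  let f : ℂ → ℂ := fun z => opTrace (opCpow (Φ σ) ((1 / 2 : ℝ) * z + (-1 / 2 : ℝ)) *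
    Φ (opCpow σ ((-1 / 2 : ℝ) * z + (1 / 2 : ℝ)) * opCpow P (α * z + (0 : ℝ)) *
      opCpow σ ((-1 / 2 : ℝ) * z + (1 / 2 : ℝ))) *
    opCpow (Φ σ) ((1 / 2 : ℝ) * z + (-1 / 2 : ℝ)) * opCpow R ((-α : ℝ) * z + α))
  have htame : TameOnStrip f := by
    refine TameOnStrip.linearMap ((LinearMap.trace ℂ K).comp (ContinuousLinearMap.coeLM ℂ))
      ((((tameOnStrip_opCpow hτ _ _).mul (TameOnStrip.linearMap Φ.toLinearMap ?_)).mul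
        (tameOnStrip_opCpow hτ _ _)).mul (tameOnStrip_opCpow hR _ _))
    exact ((tameOnStrip_opCpow hσ _ _).mul (tameOnStrip_opCpow hP _ _)).mul
      (tameOnStrip_opCpow hσ _ _)
  have h0 : ∀ z ∈ Complex.re ⁻¹' {0}, ‖f z‖ ≤ r := by
    intro z hz
    have hz : z.re = 0 := hz
    have e1 : ((1 / 2 : ℝ) * z + (-1 / 2 : ℝ) : ℂ) = -((-1 / 2 : ℝ) * z + (1 / 2 : ℝ)) := by
      push_cast; ring
    -- On Re z = 0 the first factor is an imaginary power, a contraction; the second is positive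
    -- with trace r.
    have e2 : opCpow R ((-α : ℝ) * z + α) = opCpow R ((-α : ℝ) * z) * opCpow R α := by
      rw [opCpow_mul_opCpow]
    simp only [f]
    rw [e1, e2, ← mul_assoc, opTrace_mul_comm]
    refine norm_opTrace_contraction_mul_le (norm_mul_le_one ?_ ?_) (opCpow_nonneg hR α)
    · exact norm_conj_map_opCpow_le_one Φ hσ hP (by simp [hz]) (by simp [hz])
    · exact norm_opCpow_le_one hR (by simp [hz])
  have h1 : ∀ z ∈ Complex.re ⁻¹' {1}, ‖f z‖ ≤ q := by
    intro z hz
    have hz : z.re = 1 := hz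
    simp only [f]
    rw [mul_assoc, mul_assoc, opTrace_mul_comm, mul_assoc]
    refine norm_opTrace_map_mul_le Φ hΦ hσ hP (by simp [hz]; norm_num) (by simp [hz])
      (norm_mul_le_one (norm_mul_le_one ?_ ?_) ?_)
    · exact norm_opCpow_le_one hτ (by simp [hz]; norm_num)
    · exact norm_opCpow_le_one hR (by simp [hz])
    · exact norm_opCpow_le_one hτ (by simp [hz]; norm_num)
  -- At z = 1/α the exponents of τ, σ, P and R are s, -s, 1 and α - 1: the inner operator is A by
  -- the support hypothesis, and the outer product is R · R^(α-1).
  have hval : f ((1 / α : ℝ) : ℂ) = opTrace (opCpow R α) := by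
    have hαC : (α : ℂ) ≠ 0 := by exact_mod_cast hα0.ne'
    have e1 : ((1 / 2 : ℝ) * ((1 / α : ℝ) : ℂ) + (-1 / 2 : ℝ) : ℂ) = s := by
      rw [hs]; push_cast; field_simp; ring
    have e2 : ((-1 / 2 : ℝ) * ((1 / α : ℝ) : ℂ) + (1 / 2 : ℝ) : ℂ) = -s := by
      rw [hs]; push_cast; field_simp; ring
    have e3 : (α * ((1 / α : ℝ) : ℂ) + (0 : ℝ) : ℂ) = 1 := by
      push_cast; field_simp; ring
    have e4 : ((-α : ℝ) * ((1 / α : ℝ) : ℂ) + α : ℂ) = α - 1 := by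
      push_cast; field_simp; ring
    have e5 : opCpow σ (-s) * P * opCpow σ (-s) = A := by
      rw [hPdef]
      calc _ = (opCpow σ (-s) * opCpow σ s) * A * (opCpow σ s * opCpow σ (-s)) := by
            simp only [mul_assoc]
        _ = A := by rw [opCpow_mul_opCpow, opCpow_mul_opCpow, neg_add_cancel, add_neg_cancel, hsupp]
    simp only [f]
    rw [e1, e2, e3, e4, opCpow_one hP, e5, ← hRdef]
    nth_rewrite 1 [← opCpow_one hR]
    rw [opCpow_mul_opCpow, add_sub_cancel]
  have hα1 : 1 / α ≤ 1 := by rw [div_le_one hα0]; linarith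
  have hα2 : 0 < 1 / α := by positivity
  have hmem : ((1 / α : ℝ) : ℂ) ∈ Complex.HadamardThreeLines.verticalClosedStrip 0 1 := by
    simp only [Complex.HadamardThreeLines.verticalClosedStrip, Set.mem_preimage, Complex.ofReal_re]
    exact ⟨hα2.le, hα1⟩
  have hbdd : BddAbove ((norm ∘ f) '' Complex.HadamardThreeLines.verticalClosedStrip 0 1) := by
    obtain ⟨C, hC⟩ := htame.2
    refine ⟨C, ?_⟩
    rintro _ ⟨z, hz, rfl⟩
    exact hC z hz.1 hz.2
  have h3 := Complex.HadamardThreeLines.norm_le_interp_of_mem_verticalClosedStrip₀₁' f hmem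
    htame.1.diffContOnCl hbdd h0 h1
  rw [hval, Complex.ofReal_re] at h3
  exact le_of_le_interp (opTrace_re_nonneg (opCpow_nonneg hR α))
    (opTrace_re_nonneg (opCpow_nonneg hP α)) hα2 ((Complex.re_le_norm _).trans h3)

theorem mul_opCpow_zero_of_opSupport_le {A B : H →L[ℂ] H} (hB : 0 ≤ B)
    (h : opSupport A ≤ opSupport B) : A * opCpow B 0 = A := by
  rw [opSupport_le_iff] at h
  have hBB : B * opCpow B 0 = B := by
    nth_rewrite 1 [← opCpow_one hB]
    rw [opCpow_mul_opCpow, add_zero, opCpow_one hB]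
  ext v
  have h1 : B (opCpow B 0 v - v) = 0 := by
    rw [map_sub, sub_eq_zero]
    exact congrArg (fun Z : H →L[ℂ] H => Z v) hBB
  have h2 := h _ h1
  rw [map_sub, sub_eq_zero] at h2
  exact h2

theorem opCpow_zero_conj_of_opSupport_le {A B : H →L[ℂ] H} (hA : 0 ≤ A) (hB : 0 ≤ B)
    (h : opSupport A ≤ opSupport B) : opCpow B 0 * A * opCpow B 0 = A := by
  have h1 := mul_opCpow_zero_of_opSupport_le hB h
  have h2 : opCpow B 0 * A = A := by
    have := congrArg star h1
    rwa [star_mul, (IsSelfAdjoint.of_nonneg hA).star_eq,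
      (IsSelfAdjoint.of_nonneg (opCpow_zero_nonneg hB)).star_eq] at this
  rw [h2, h1]

/-- A positive operator is bounded by a multiple of any positive operator with larger support. -/
theorem exists_le_smul_of_opSupport_le {A B : H →L[ℂ] H} (hA : 0 ≤ A) (hB : 0 ≤ B)
    (h : opSupport A ≤ opSupport B) : ∃ c : ℝ, A ≤ (c : ℂ) • B := by
  -- Conjugating X ≤ ‖X‖ by B^(1/2) gives A ≤ ‖X‖ B, since the support projection of B fixes A.
  set X := opCpow B ((-1 / 2 : ℝ) : ℂ) * A * opCpow B ((-1 / 2 : ℝ) : ℂ) with hX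
  have hX0 : 0 ≤ X := opCpow_conj_nonneg hB hA _
  have hle : X ≤ algebraMap ℝ _ ‖X‖ := IsSelfAdjoint.le_algebraMap_norm_self (.of_nonneg hX0)
  have hconj := star_left_conjugate_le_conjugate hle (opCpow B ((1 / 2 : ℝ) : ℂ))
  rw [isSelfAdjoint_opCpow hB] at hconj
  refine ⟨‖X‖, ?_⟩
  have e1 : opCpow B ((1 / 2 : ℝ) : ℂ) * X * opCpow B ((1 / 2 : ℝ) : ℂ) = A := by
    calc _ = (opCpow B ((1 / 2 : ℝ) : ℂ) * opCpow B ((-1 / 2 : ℝ) : ℂ)) * A *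
          (opCpow B ((-1 / 2 : ℝ) : ℂ) * opCpow B ((1 / 2 : ℝ) : ℂ)) := by
          simp only [hX, mul_assoc]
      _ = opCpow B 0 * A * opCpow B 0 := by
          rw [opCpow_mul_opCpow, opCpow_mul_opCpow, ← Complex.ofReal_add, ← Complex.ofReal_add]
          norm_num
      _ = A := opCpow_zero_conj_of_opSupport_le hA hB h
  have e2 : opCpow B ((1 / 2 : ℝ) : ℂ) * algebraMap ℝ _ ‖X‖ * opCpow B ((1 / 2 : ℝ) : ℂ) =
      ((‖X‖ : ℝ) : ℂ) • B := by
    rw [← Algebra.commutes, mul_assoc, opCpow_mul_opCpow, ← Complex.ofReal_add, add_halves,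
      Complex.ofReal_one, opCpow_one hB, ← Algebra.smul_def]
    rfl
  rwa [e1, e2] at hconj

theorem opSupport_map_le (Φ : (H →L[ℂ] H) →CP (K →L[ℂ] K)) {A B : H →L[ℂ] H} (hA : 0 ≤ A)
    (hB : 0 ≤ B) (h : opSupport A ≤ opSupport B) : opSupport (Φ A) ≤ opSupport (Φ B) := by
  obtain ⟨c, hc⟩ := exists_le_smul_of_opSupport_le hA hB h
  have hle : Φ A ≤ (c : ℂ) • Φ B := by
    rw [← map_smul]
    exact OrderHomClass.mono Φ hc
  rw [opSupport_le_iff]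
  intro v hv
  exact apply_eq_zero_of_le (map_nonneg Φ hA) hle (by simp [hv])

theorem sandwichedQ_of_opSupport_le {α : ℝ} (hα : 1 < α) {A B : H →L[ℂ] H} (hA : 0 ≤ A)
    (hB : 0 ≤ B) (h : opSupport A ≤ opSupport B) :
    sandwichedQ α A B = ENNReal.ofReal (opTrace (opCpow
      (opCpow B ((1 - α) / (2 * α) : ℝ) * A * opCpow B ((1 - α) / (2 * α) : ℝ)) α)).re := by
  have hs : (1 - α) / (2 * α) ≠ 0 :=
    div_ne_zero (by linarith) (by linarith)
  rw [sandwichedQ, if_pos h, rpow_eq_opCpow hB hs,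
    rpow_eq_opCpow (opCpow_conj_nonneg hB hA _) (by linarith)]

theorem sandwichedQ_map_le {α : ℝ} (hα : 1 < α) (N : (H →L[ℂ] H) →ₗ[ℂ] (K →L[ℂ] K))
    (hN : IsQuantumChannel N) {A B : H →L[ℂ] H} (hA : 0 ≤ A) (hB : 0 ≤ B) :
    sandwichedQ α (N A) (N B) ≤ sandwichedQ α A B := by
  obtain ⟨⟨Φ, rfl⟩, hΦ⟩ := hN
  by_cases h : opSupport A ≤ opSupport B
  · have h' : opSupport (Φ A) ≤ opSupport (Φ B) := opSupport_map_le Φ hA hB h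
    change sandwichedQ α (Φ A) (Φ B) ≤ _
    rw [sandwichedQ_of_opSupport_le hα hA hB h,
      sandwichedQ_of_opSupport_le hα (map_nonneg Φ hA) (map_nonneg Φ hB) h']
    exact ENNReal.ofReal_le_ofReal (opTrace_sandwiched_map_le Φ hΦ hA hB
      (opCpow_zero_conj_of_opSupport_le hA hB h) hα rfl)
  · rw [sandwichedQ.eq_def α A B, if_neg h]
    exact le_top

end Monotonicity

end

theorem mainTheorem3 {H K : Type*}
    [NormedAddCommGroup H] [InnerProductSpace ℂ H] [FiniteDimensional ℂ H] [CompleteSpace H]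
    [NormedAddCommGroup K] [InnerProductSpace ℂ K] [FiniteDimensional ℂ K] [CompleteSpace K]
    (α : ℝ) (hα : α ∈ Set.Ioc (1 : ℝ) 2)
    (N : (H →L[ℂ] H) →ₗ[ℂ] (K →L[ℂ] K)) (hN : IsQuantumChannel N)
    (A B : H →L[ℂ] H) (hA : 0 ≤ A) (hB : 0 ≤ B) :
    sandwichedQ α (N A) (N B) ≤ sandwichedQ α A B ∧
      sandwichedD α (N A) (N B) ≤ sandwichedD α A B :=
  have hQ := sandwichedQ_map_le hα.1 N hN hA hB
  ⟨hQ, sandwichedD_le_of_sandwichedQ_le hα.1 hQ⟩
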